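/- A real matrix is called totally nonnegative (TN) if all its minors are nonnegative, and totally positive (TP) if all its minors are strictly positive. For a matrix $A=(a_{ij})$ with nonnegative real entries and a real number $t>0$, its Hadamard power $A^{\circ t}$ is the matrix with entries $(A^{\circ t})_{ij}=a_{ij}^{\,t}$. The Hadamard critical exponent of a class $\mathcal C$ of matrices with nonnegative entries is the least real number $s$ (if there is one) such that $A^{\circ t}\in\mathcal C$ for all $A\in\mathcal C$ and all real $t>0$ with $t\ge s$. If $A$ is a $4\times 4$ symmetric TN (resp. TP) real matrix, then $A^{\circ t}$ is TN (resp. TP) for all real $t\ge 2$. Moreover, the Hadamard critical exponent of the class of $4\times4$ symmetric TN matrices is $2$, and so is that of the class of $4\times 4$ symmetric TP matrices. -/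

import Mathlib

/-- A real `m × n` matrix is totally nonnegative (TN) if all its minors are nonnegative. A `k × k`
minor is given by choosing `k` rows and `k` columns, both kept in their original order. -/
def IsTotallyNonneg {m n : ℕ} (A : Matrix (Fin m) (Fin n) ℝ) : Prop :=
  ∀ (k : ℕ) (r : Fin k ↪o Fin m) (c : Fin k ↪o Fin n), 0 ≤ (A.submatrix r c).det

/-- A real `m × n` matrix is totally positive (TP) if all its minors are (strictly) positive.
The empty minor `k = 0` equals `1` and imposes no condition. -/
def IsTotallyPos {m n : ℕ} (A : Matrix (Fin m) (Fin n) ℝ) : Prop :=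
  ∀ (k : ℕ) (r : Fin k ↪o Fin m) (c : Fin k ↪o Fin n), 0 < (A.submatrix r c).det

/-- The Hadamard (entrywise) power with entries `(A i j) ^ t`. It is used only for matrices with
nonnegative entries and for real `t > 0`, where `Real.rpow` is the usual power (`0 ^ t = 0`). -/
noncomputable def hadamardPow {m n : ℕ} (A : Matrix (Fin m) (Fin n) ℝ) (t : ℝ) :
    Matrix (Fin m) (Fin n) ℝ :=
  Matrix.of fun i j => A i j ^ t

/-- `c` is the Hadamard critical exponent of a class `C` of matrices (with nonnegative entries):
the least real number `s` such that for every (positive) real `t ≥ s`, the class `C` is closed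
under the `t`-th Hadamard power. -/
def IsHadamardCriticalExponent {m n : ℕ} (C : Set (Matrix (Fin m) (Fin n) ℝ)) (c : ℝ) : Prop :=
  IsLeast {s : ℝ | ∀ t : ℝ, 0 < t → s ≤ t → ∀ A ∈ C, hadamardPow A t ∈ C} c

/-!
Minors of size at most three and the determinant of a symmetric `4 × 4` matrix `A` need different
arguments, which work for `t ≥ 1` and for `t ≥ 2` respectively.

For a totally nonnegative `3 × 3` matrix, condensation at the corner entry turns the determinant of
the `t`-th Hadamard power into `F p * F s - F q * F r` with `F x = (1 + x) ^ t - 1`, up to a positive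
factor, where `p ≤ q`, `p ≤ r` and `q r ≤ p s`. Since `u ↦ log (F (exp u))` is increasing and convex
for `t ≥ 1`, this is nonnegative (`rpow_sub_one_mul_le`). Matrices with zeros in the first row or
column are either degenerate or have a zero anti-diagonal corner, and in the latter case convexity
of `x ↦ x ^ t` suffices.

The `4 × 4` determinant is controlled by positive semidefiniteness. A symmetric totally nonnegative
matrix has nonnegative principal minors, hence is positive semidefinite
(`IsTotallyNonneg.posSemidef`), and the FitzGerald–Horn theorem (`Matrix.PosSemidef.hadamardPow`)
says that the `t`-th Hadamard power is positive semidefinite again if `t ≥ 4 - 2`.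

Strict positivity follows from nonnegativity of the same determinants: lowering the corner entry of
a totally positive matrix slightly keeps it totally positive and lowers the determinant of the
Hadamard power by a positive multiple of a smaller minor (`IsTotallyPos.det_hadamardPow_pos`).

For `1 < t < 2` the power of `(1 + e i j)` with `0 ≤ i, j ≤ 3` and small `e > 0` is not positive
semidefinite: on the vector of third differences the leading term is a positive multiple of
`t (t - 1) (t - 2) e ^ 3`. A perturbation of this matrix is symmetric and totally positive
(`momentMatrix_isTotallyPos`), so one matrix shows that neither class is closed under the power `t`.
Every `s < 2` has such a `t` above it, so no smaller exponent is critical.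
-/

open Filter Topology

variable {m n k l : ℕ}

/-! ### Real powers -/

/-- Up to the denominators, `x (1 + x) ^ (t - 1) / ((1 + x) ^ t - 1)` increases with `x > 0`. It
follows from the concavity of `x ↦ (1 + x) - (1 + x) ^ (1 - t)`, which vanishes at `0`. -/
theorem mul_rpow_sub_one_le {t x y : ℝ} (ht : 1 ≤ t) (hx : 0 < x) (hxy : x ≤ y) :
    x * (1 + x) ^ (t - 1) * ((1 + y) ^ t - 1) ≤ y * (1 + y) ^ (t - 1) * ((1 + x) ^ t - 1) := by
  have hy : 0 < y := hx.trans_le hxy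
  have hu : 0 < 1 + x := by linarith
  have hw : 0 < 1 + y := by linarith
  have hθ0 : 0 ≤ x / y := by positivity
  have hθ1 : x / y ≤ 1 := (div_le_one hy).2 hxy
  -- Bernoulli's inequality: `(1 + y) ^ (x / y) ≤ 1 + x`.
  have hB : (1 + y) ^ (x / y) ≤ 1 + x := by
    have := rpow_one_add_le_one_add_mul_self (s := y) (by linarith) hθ0 hθ1
    rwa [div_mul_cancel₀ _ hy.ne'] at this
  -- Weighted arithmetic-geometric mean inequality for `1` and `(1 + y) ^ (1 - t)`.
  have hAG := Real.geom_mean_le_arith_mean2_weighted (sub_nonneg.2 hθ1) hθ0 zero_le_one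
    (Real.rpow_nonneg hw.le (1 - t)) (by ring)
  have hle : (1 + x) ^ (1 - t) ≤ ((1 + y) ^ (1 - t)) ^ (x / y) := by
    rw [← Real.rpow_mul hw.le, mul_comm, Real.rpow_mul hw.le]
    exact Real.rpow_le_rpow_of_nonpos (by positivity) hB (by linarith)
  rw [Real.one_rpow, one_mul] at hAG
  have hK : y * (1 + x) ^ (1 - t) ≤ (y - x) + x * (1 + y) ^ (1 - t) := by
    have := mul_le_mul_of_nonneg_left (hle.trans hAG) hy.le
    calc _ ≤ _ := this
      _ = _ := by field_simp
  have e1 : (1 + x) ^ (1 - t) * (1 + x) ^ (t - 1) = 1 := by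
    rw [← Real.rpow_add hu]; simp
  have e2 : (1 + y) ^ (1 - t) * (1 + y) ^ (t - 1) = 1 := by
    rw [← Real.rpow_add hw]; simp
  have e3 : (1 + x) ^ t = (1 + x) * (1 + x) ^ (t - 1) := by
    rw [Real.rpow_sub_one hu.ne']; field_simp
  have e4 : (1 + y) ^ t = (1 + y) * (1 + y) ^ (t - 1) := by
    rw [Real.rpow_sub_one hw.ne']; field_simp
  rw [e3, e4]
  have hP : 0 ≤ (1 + x) ^ (t - 1) * (1 + y) ^ (t - 1) := by positivity
  have := mul_le_mul_of_nonneg_left hK hP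
  linear_combination this - y * (1 + y) ^ (t - 1) * e1 + x * (1 + x) ^ (t - 1) * e2

theorem one_add_rpow_sub_one_pos {t x : ℝ} (ht : 1 ≤ t) (hx : 0 < x) : 0 < (1 + x) ^ t - 1 :=
  sub_pos.2 (Real.one_lt_rpow (by linarith) (by linarith))

/-- For `l ≥ 1` the quotient `((1 + l x) ^ t - 1) / ((1 + x) ^ t - 1)` increases with `x > 0`. -/
theorem monotoneOn_rpow_sub_one_div {t l : ℝ} (ht : 1 ≤ t) (hl : 1 ≤ l) :
    MonotoneOn (fun x : ℝ => ((1 + l * x) ^ t - 1) / ((1 + x) ^ t - 1)) (Set.Ioi 0) := by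
  have hd : ∀ x ∈ Set.Ioi (0 : ℝ), HasDerivAt
      (fun x : ℝ => ((1 + l * x) ^ t - 1) / ((1 + x) ^ t - 1))
      (((l * t * (1 + l * x) ^ (t - 1)) * ((1 + x) ^ t - 1)
        - ((1 + l * x) ^ t - 1) * (1 * t * (1 + x) ^ (t - 1))) / ((1 + x) ^ t - 1) ^ 2) x := by
    intro x hx
    have h1 : HasDerivAt (fun x : ℝ => 1 + l * x) l x := by
      simpa using ((hasDerivAt_id x).const_mul l).const_add 1
    have h2 : HasDerivAt (fun x : ℝ => 1 + x) 1 x := (hasDerivAt_id x).const_add 1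
    exact ((h1.rpow_const (Or.inr ht)).sub_const 1).div ((h2.rpow_const (Or.inr ht)).sub_const 1)
      (one_add_rpow_sub_one_pos ht hx).ne'
  refine monotoneOn_of_deriv_nonneg (convex_Ioi 0)
    (fun x hx => (hd x hx).continuousAt.continuousWithinAt) ?_ ?_
  · rw [interior_Ioi]
    exact fun x hx => (hd x hx).differentiableAt.differentiableWithinAt
  · rw [interior_Ioi]
    intro x hx
    have hx0 : (0 : ℝ) < x := hx
    rw [(hd x hx).deriv]
    refine div_nonneg ?_ (sq_nonneg _)
    have h := mul_rpow_sub_one_le ht hx0 (le_mul_of_one_le_left hx0.le hl)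
    refine (mul_nonneg_iff_of_pos_left hx0).1 ?_
    have := mul_le_mul_of_nonneg_left h (by linarith : (0 : ℝ) ≤ t)
    linear_combination this

/-- The function `u ↦ log ((1 + exp u) ^ t - 1)` is convex and increasing, here in multiplicative
form and with the value `0` of `p`, `q`, `r`, `s` allowed. -/
theorem rpow_sub_one_mul_le {t p q r s : ℝ} (ht : 1 ≤ t) (hp : 0 ≤ p) (hpq : p ≤ q) (hpr : p ≤ r)
    (h : q * r ≤ p * s) :
    ((1 + q) ^ t - 1) * ((1 + r) ^ t - 1) ≤ ((1 + p) ^ t - 1) * ((1 + s) ^ t - 1) := by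
  rcases hp.eq_or_lt with rfl | hp
  · have : q * r = 0 := le_antisymm (by linarith) (mul_nonneg hpq hpr)
    rcases mul_eq_zero.1 this with rfl | rfl <;> simp
  · have hq : 0 < q := hp.trans_le hpq
    have hr : 0 < r := hp.trans_le hpr
    have hm := monotoneOn_rpow_sub_one_div ht ((one_le_div hp).2 hpq) hp hr hpr
    have hs' : q / p * r ≤ s := by
      rw [div_mul_eq_mul_div, div_le_iff₀ hp]; linarith
    have hF : (1 + q / p * r) ^ t ≤ (1 + s) ^ t := by gcongr
    simp only [div_mul_cancel₀ _ hp.ne'] at hm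
    rw [div_le_div_iff₀ (one_add_rpow_sub_one_pos ht hp) (one_add_rpow_sub_one_pos ht hr)] at hm
    have := mul_le_mul_of_nonneg_left hF (one_add_rpow_sub_one_pos ht hp).le
    linarith

/-- Convexity of `x ↦ x ^ t`: a gap that is wider and lies further to the right keeps its lead. -/
theorem rpow_sub_rpow_le_of_sub_le {t u v w z : ℝ} (ht : 1 ≤ t) (hz : 0 ≤ z) (hzv : z ≤ v)
    (hzw : z ≤ w) (h : w - z ≤ u - v) : w ^ t - z ^ t ≤ u ^ t - v ^ t := by
  rcases hzw.eq_or_lt with rfl | hzw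
  · have : v ^ t ≤ u ^ t := Real.rpow_le_rpow (hz.trans hzv) (by linarith) (by linarith)
    linarith
  have hmono : MonotoneOn (fun x : ℝ => (x + (w - z)) ^ t - x ^ t) (Set.Ici 0) := by
    have hd : ∀ x : ℝ, HasDerivAt (fun x : ℝ => (x + (w - z)) ^ t - x ^ t)
        (1 * t * (x + (w - z)) ^ (t - 1) - 1 * t * x ^ (t - 1)) x := fun x =>
      (((hasDerivAt_id x).add_const _).rpow_const (Or.inr ht)).sub
        ((hasDerivAt_id x).rpow_const (Or.inr ht))
    refine monotoneOn_of_deriv_nonneg (convex_Ici 0)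
      (fun x _ => (hd x).continuousAt.continuousWithinAt)
      (fun x _ => (hd x).differentiableAt.differentiableWithinAt) ?_
    rw [interior_Ici]
    intro x hx
    have hx0 : (0 : ℝ) < x := hx
    rw [(hd x).deriv]
    have : x ^ (t - 1) ≤ (x + (w - z)) ^ (t - 1) :=
      Real.rpow_le_rpow hx0.le (by linarith) (by linarith)
    nlinarith
  have h1 := hmono hz (hz.trans hzv) hzv
  have h2 : (v + (w - z)) ^ t ≤ u ^ t :=
    Real.rpow_le_rpow (by linarith) (by linarith) (by linarith)
  simp only [add_sub_cancel] at h1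
  linarith

/-! ### Totally nonnegative matrices up to size three -/

theorem IsTotallyPos.isTotallyNonneg {A : Matrix (Fin m) (Fin n) ℝ} (hA : IsTotallyPos A) :
    IsTotallyNonneg A :=
  fun k r c => (hA k r c).le

theorem IsTotallyNonneg.submatrix {A : Matrix (Fin m) (Fin n) ℝ} (hA : IsTotallyNonneg A)
    (r : Fin k ↪o Fin m) (c : Fin l ↪o Fin n) : IsTotallyNonneg (A.submatrix r c) :=
  fun j r' c' => hA j (r'.trans r) (c'.trans c)

theorem IsTotallyPos.submatrix {A : Matrix (Fin m) (Fin n) ℝ} (hA : IsTotallyPos A)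
    (r : Fin k ↪o Fin m) (c : Fin l ↪o Fin n) : IsTotallyPos (A.submatrix r c) :=
  fun j r' c' => hA j (r'.trans r) (c'.trans c)

theorem IsTotallyNonneg.det_nonneg {A : Matrix (Fin n) (Fin n) ℝ} (hA : IsTotallyNonneg A) :
    0 ≤ A.det :=
  hA n (RelEmbedding.refl _) (RelEmbedding.refl _)

theorem IsTotallyNonneg.entry_nonneg {A : Matrix (Fin m) (Fin n) ℝ} (hA : IsTotallyNonneg A)
    (i : Fin m) (j : Fin n) : 0 ≤ A i j := by
  simpa using hA 1 (OrderEmbedding.ofStrictMono (fun _ : Fin 1 => i) (Subsingleton.strictMono _))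
    (OrderEmbedding.ofStrictMono (fun _ : Fin 1 => j) (Subsingleton.strictMono _))

theorem IsTotallyNonneg.mul_le_mul {A : Matrix (Fin m) (Fin n) ℝ} (hA : IsTotallyNonneg A)
    {i i' : Fin m} {j j' : Fin n} (hi : i < i') (hj : j < j') :
    A i j' * A i' j ≤ A i j * A i' j' := by
  have h := hA 2 (OrderEmbedding.ofStrictMono ![i, i'] (by simpa [strictMono_vecCons] using hi))
    (OrderEmbedding.ofStrictMono ![j, j'] (by simpa [strictMono_vecCons] using hj))
  rw [Matrix.det_fin_two] at h
  simpa using h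

theorem hadamardPow_submatrix (A : Matrix (Fin m) (Fin n) ℝ) (t : ℝ) (r : Fin k → Fin m)
    (c : Fin l → Fin n) :
    (hadamardPow A t).submatrix r c = hadamardPow (A.submatrix r c) t :=
  rfl

theorem IsTotallyNonneg.det_hadamardPow_fin_two {A : Matrix (Fin 2) (Fin 2) ℝ}
    (hA : IsTotallyNonneg A) {t : ℝ} (ht : 0 ≤ t) : 0 ≤ (hadamardPow A t).det := by
  have h := Real.rpow_le_rpow (mul_nonneg (hA.entry_nonneg 0 1) (hA.entry_nonneg 1 0))
    (hA.mul_le_mul (i := 0) (i' := 1) (j := 0) (j' := 1) (by decide) (by decide)) ht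
  rw [Real.mul_rpow (hA.entry_nonneg _ _) (hA.entry_nonneg _ _),
    Real.mul_rpow (hA.entry_nonneg _ _) (hA.entry_nonneg _ _)] at h
  simpa [Matrix.det_fin_two, hadamardPow] using h

/-- The determinant of the Hadamard power of `!![a, b, c; d, e, f; g, h, i]` when no entry of the
first row or column vanishes: Sylvester's identity (Chio condensation) at the pivot `a` reduces the
claim to `rpow_sub_one_mul_le`. -/
theorem det_three_rpow_nonneg_of_pos {t a b c d e f g h i : ℝ} (ht : 1 ≤ t) (ha : 0 < a)
    (hb : 0 < b) (hc : 0 < c) (hd : 0 < d) (hg : 0 < g) (he : 0 ≤ e) (hf : 0 ≤ f) (hh : 0 ≤ h)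
    (hi : 0 ≤ i) (h1 : b * d ≤ a * e) (h2 : c * e ≤ b * f) (h3 : e * g ≤ d * h)
    (hdet : 0 ≤ a * (e * i - f * h) - b * (d * i - f * g) + c * (d * h - e * g)) :
    0 ≤ a ^ t * (e ^ t * i ^ t - f ^ t * h ^ t) - b ^ t * (d ^ t * i ^ t - f ^ t * g ^ t)
      + c ^ t * (d ^ t * h ^ t - e ^ t * g ^ t) := by
  have key := rpow_sub_one_mul_le (p := a * e / (b * d) - 1) (q := a * f / (c * d) - 1)
    (r := a * h / (b * g) - 1) (s := a * i / (c * g) - 1) ht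
    (by rw [sub_nonneg, one_le_div (by positivity)]; exact h1)
    (by
      rw [sub_le_sub_iff_right, div_le_div_iff₀ (by positivity) (by positivity)]
      have := mul_le_mul_of_nonneg_left h2 (by positivity : 0 ≤ a * d)
      linarith)
    (by
      rw [sub_le_sub_iff_right, div_le_div_iff₀ (by positivity) (by positivity)]
      have := mul_le_mul_of_nonneg_left h3 (by positivity : 0 ≤ a * b)
      linarith)
    (by
      rw [← sub_nonneg]
      have : (a * e / (b * d) - 1) * (a * i / (c * g) - 1)
          - (a * f / (c * d) - 1) * (a * h / (b * g) - 1)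
          = a * (a * (e * i - f * h) - b * (d * i - f * g) + c * (d * h - e * g))
            / (b * c * d * g) := by
        field_simp
        ring
      rw [this]
      positivity)
  simp only [add_sub_cancel] at key
  rw [Real.div_rpow (by positivity) (by positivity), Real.div_rpow (by positivity) (by positivity),
    Real.div_rpow (by positivity) (by positivity), Real.div_rpow (by positivity) (by positivity)]
    at key
  simp only [Real.mul_rpow ha.le he, Real.mul_rpow ha.le hf, Real.mul_rpow ha.le hh,
    Real.mul_rpow ha.le hi, Real.mul_rpow hb.le hd.le, Real.mul_rpow hc.le hd.le,
    Real.mul_rpow hb.le hg.le, Real.mul_rpow hc.le hg.le] at key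
  have pa := Real.rpow_pos_of_pos ha t
  have pb := Real.rpow_pos_of_pos hb t
  have pc := Real.rpow_pos_of_pos hc t
  have pd := Real.rpow_pos_of_pos hd t
  have pg := Real.rpow_pos_of_pos hg t
  generalize a ^ t = A at *
  generalize b ^ t = B at *
  generalize c ^ t = C at *
  generalize d ^ t = D at *
  generalize e ^ t = E at *
  generalize f ^ t = F at *
  generalize g ^ t = G at *
  generalize h ^ t = H at *
  generalize i ^ t = I at *
  rw [← sub_nonneg] at key
  have : (A * E / (B * D) - 1) * (A * I / (C * G) - 1)
      - (A * F / (C * D) - 1) * (A * H / (B * G) - 1)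
      = A * (A * (E * I - F * H) - B * (D * I - F * G) + C * (D * H - E * G))
        / (B * C * D * G) := by
    field_simp
    ring
  rw [this] at key
  rw [le_div_iff₀ (by positivity), zero_mul] at key
  exact (mul_nonneg_iff_of_pos_left pa).1 key

/-- The determinant of the Hadamard power of `!![a, b, 0; d, e, f; g, h, i]`. It is the comparison
of two differences of `t`-th powers, `a e i` to `b d i` and `a f h` to `b f g`. -/
theorem det_three_rpow_nonneg_of_corner {t a b d e f g h i : ℝ} (ht : 1 ≤ t) (ha : 0 ≤ a)
    (hb : 0 ≤ b) (hd : 0 ≤ d) (hg : 0 ≤ g) (he : 0 ≤ e) (hf : 0 ≤ f) (hh : 0 ≤ h)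
    (hi : 0 ≤ i) (h1 : b * g ≤ a * h) (h2 : f * g ≤ d * i)
    (hdet : 0 ≤ a * (e * i - f * h) - b * (d * i - f * g)) :
    0 ≤ a ^ t * (e ^ t * i ^ t - f ^ t * h ^ t) - b ^ t * (d ^ t * i ^ t - f ^ t * g ^ t) := by
  have key := rpow_sub_rpow_le_of_sub_le (u := a * e * i) (v := b * d * i) (w := a * f * h)
    (z := b * f * g) ht (by positivity)
    (by have := mul_le_mul_of_nonneg_left h2 hb; linarith)
    (by have := mul_le_mul_of_nonneg_left h1 hf; linarith) (by linarith)
  rw [Real.mul_rpow (by positivity) (by positivity), Real.mul_rpow (by positivity) (by positivity),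
    Real.mul_rpow (by positivity) (by positivity), Real.mul_rpow (by positivity) (by positivity),
    Real.mul_rpow (by positivity) (by positivity), Real.mul_rpow (by positivity) (by positivity),
    Real.mul_rpow (by positivity) (by positivity), Real.mul_rpow (by positivity) (by positivity)]
    at key
  linarith

theorem IsTotallyNonneg.det_hadamardPow_fin_three {A : Matrix (Fin 3) (Fin 3) ℝ}
    (hA : IsTotallyNonneg A) {t : ℝ} (ht : 1 ≤ t) : 0 ≤ (hadamardPow A t).det := by
  have e := hA.entry_nonneg
  have M := fun i i' j j' hi hj => hA.mul_le_mul (i := i) (i' := i') (j := j) (j' := j') hi hj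
  have hdet := hA.det_nonneg
  rw [Matrix.det_fin_three] at hdet ⊢
  simp only [hadamardPow, Matrix.of_apply]
  have m1 := M 0 1 0 1 (by decide) (by decide)
  have m2 := M 0 1 1 2 (by decide) (by decide)
  have m3 := M 1 2 0 1 (by decide) (by decide)
  have m4 := M 0 2 0 1 (by decide) (by decide)
  have m5 := M 1 2 0 2 (by decide) (by decide)
  have m6 := M 0 1 0 2 (by decide) (by decide)
  have m7 := M 1 2 1 2 (by decide) (by decide)
  have m8 := M 0 2 0 2 (by decide) (by decide)
  have m9 := M 0 2 1 2 (by decide) (by decide)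
  have e00 := e 0 0
  have e01 := e 0 1
  have e02 := e 0 2
  have e10 := e 1 0
  have e11 := e 1 1
  have e12 := e 1 2
  have e20 := e 2 0
  have e21 := e 2 1
  have e22 := e 2 2
  clear M e hA
  generalize A 0 0 = a at *
  generalize A 0 1 = b at *
  generalize A 0 2 = c at *
  generalize A 1 0 = d at *
  generalize A 1 1 = e at *
  generalize A 1 2 = f at *
  generalize A 2 0 = g at *
  generalize A 2 1 = h at *
  generalize A 2 2 = i at *
  have z : (0 : ℝ) ^ t = 0 := Real.zero_rpow (by linarith)
  have hfh : 0 ≤ e ^ t * i ^ t - f ^ t * h ^ t := by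
    rw [← Real.mul_rpow e11 e22, ← Real.mul_rpow e12 e21, sub_nonneg]
    exact Real.rpow_le_rpow (by positivity) m7 (by linarith)
  have zero_of : ∀ {x y : ℝ}, 0 ≤ x → 0 ≤ y → x * y ≤ 0 → x = 0 ∨ y = 0 := fun hx hy h =>
    mul_eq_zero.1 (h.antisymm (mul_nonneg hx hy))
  rcases e02.eq_or_lt with rfl | c0
  · have := det_three_rpow_nonneg_of_corner ht e00 e01 e10 e20 e11 e12 e21 e22 m4 m5 (by linarith)
    rw [z]
    linarith
  rcases e20.eq_or_lt with rfl | g0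
  · have := det_three_rpow_nonneg_of_corner ht e00 e10 e01 e02 e11 e21 e12 e22 (by linarith)
      (by linarith) (by linarith)
    rw [z]
    linarith
  -- With both corners `c` and `g` positive, so is every entry of the first row and column,
  -- unless a column or a row vanishes.
  have a0 : 0 < a := by
    rcases e00.eq_or_lt with rfl | h
    · have := mul_pos c0 g0
      linarith
    · exact h
  rcases e01.eq_or_lt with rfl | b0
  · obtain rfl : e = 0 := by
      rcases zero_of e02 e11 (by linarith) with h | h
      · exact absurd h c0.ne'
      · exact h
    obtain rfl : h = 0 := by
      rcases zero_of e02 e21 (by linarith) with h | h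
      · exact absurd h c0.ne'
      · exact h
    simp [z]
  rcases e10.eq_or_lt with rfl | d0
  · obtain rfl : e = 0 := by
      rcases zero_of e11 e20 (by linarith) with h | h
      · exact h
      · exact absurd h g0.ne'
    obtain rfl : f = 0 := by
      rcases zero_of e12 e20 (by linarith) with h | h
      · exact h
      · exact absurd h g0.ne'
    simp [z]
  have := det_three_rpow_nonneg_of_pos ht a0 b0 c0 d0 g0 e11 e12 e21 e22 m1 m2 m3 (by linarith)
  linarith

/-! ### Hadamard powers of positive semidefinite matrices -/

open Matrix in
theorem posSemidef_iff_sum {ι : Type*} [Fintype ι] {A : Matrix ι ι ℝ} :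
    A.PosSemidef ↔ A.IsSymm ∧ ∀ x : ι → ℝ, 0 ≤ ∑ i, ∑ j, x i * A i j * x j := by
  rw [Matrix.posSemidef_iff_dotProduct_mulVec]
  have (x : ι → ℝ) : star x ⬝ᵥ A *ᵥ x = ∑ i, ∑ j, x i * A i j * x j := by
    simp [dotProduct, mulVec, Finset.mul_sum, mul_assoc]
  simp only [this]
  rfl

theorem Matrix.PosSemidef.sq_le_mul {ι : Type*} [Finite ι] {A : Matrix ι ι ℝ}
    (hA : A.PosSemidef) (i j : ι) : A i j ^ 2 ≤ A i i * A j j := by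
  have h := (hA.submatrix ![i, j]).det_nonneg
  have hs : A j i = A i j := hA.1.apply i j
  rw [Matrix.det_fin_two] at h
  simp [hs] at h
  linarith

/-- The Schur complement of the entry `(0, 0)`, kept on the full index set. If `A 0 0 = 0`, the
convention `x / 0 = 0` makes it `A` itself. -/
theorem Matrix.PosSemidef.schurComplement_zero {A : Matrix (Fin (n + 1)) (Fin (n + 1)) ℝ}
    (hA : A.PosSemidef) :
    (Matrix.of fun i j => A i j - A i 0 * A j 0 / A 0 0).PosSemidef := by
  obtain ⟨hs, hq⟩ := posSemidef_iff_sum.1 hA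
  refine posSemidef_iff_sum.2 ⟨?_, fun x => ?_⟩
  · ext i j
    simp [hs.apply i j, mul_comm]
  · rcases eq_or_ne (A 0 0) 0 with h0 | h0
    · simpa [h0] using hq x
    · set c := (∑ i, x i * A i 0) / A 0 0 with hc
      -- `c` minimizes the quadratic form of `A` along the line through `x` in the direction `e₀`.
      have h := hq (fun i => x i - if i = 0 then c else 0)
      have e : ∑ i, ∑ j, (x i - if i = 0 then c else 0) * A i j * (x j - if j = 0 then c else 0)
          = (∑ i, ∑ j, x i * A i j * x j) - c * (∑ i, x i * A i 0) - c * (∑ j, A 0 j * x j)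
            + c * c * A 0 0 := by
        simp only [sub_mul, mul_sub, Finset.sum_sub_distrib, ite_mul, mul_ite, zero_mul, mul_zero,
          Finset.sum_ite_eq', Finset.mem_univ, if_true, Finset.mul_sum,
          Finset.sum_ite_irrel, Finset.sum_const_zero]
        ring_nf
      have e' : ∑ j, A 0 j * x j = ∑ i, x i * A i 0 :=
        Finset.sum_congr rfl fun i _ => by rw [hs.apply i 0, mul_comm]
      have e'' : ∑ i, ∑ j, x i * (A i j - A i 0 * A j 0 / A 0 0) * x j
          = (∑ i, ∑ j, x i * A i j * x j) - (∑ i, x i * A i 0) * (∑ i, x i * A i 0) / A 0 0 := by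
        rw [Finset.sum_mul_sum, Finset.sum_div, ← Finset.sum_sub_distrib]
        refine Finset.sum_congr rfl fun i _ => ?_
        rw [Finset.sum_div, ← Finset.sum_sub_distrib]
        refine Finset.sum_congr rfl fun j _ => ?_
        ring
      rw [e, e'] at h
      simp only [Matrix.of_apply]
      rw [e'']
      have hc' : c * A 0 0 = ∑ i, x i * A i 0 := by rw [hc]; field_simp
      have : (∑ i, x i * A i 0) * (∑ i, x i * A i 0) / A 0 0 = c * ∑ i, x i * A i 0 := by
        rw [hc]; ring
      rw [this]
      have : c * (c * A 0 0) = c * ∑ i, x i * A i 0 := by rw [hc']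
      linarith

theorem Matrix.PosSemidef.hadamardPow_fin_two {A : Matrix (Fin 2) (Fin 2) ℝ}
    (hA : A.PosSemidef) (hnn : ∀ i j, 0 ≤ A i j) {t : ℝ} (ht : 0 ≤ t) :
    (hadamardPow A t).PosSemidef := by
  have hs : A 1 0 = A 0 1 := hA.1.apply 0 1
  have h := hA.sq_le_mul 0 1
  refine posSemidef_iff_sum.2 ⟨?_, fun x => ?_⟩
  · ext i j
    simp only [hadamardPow, Matrix.transpose_apply, Matrix.of_apply]
    rw [show A j i = A i j from hA.1.apply i j]
  simp only [Fin.sum_univ_two, hadamardPow, Matrix.of_apply, hs]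
  have p0 := Real.rpow_nonneg (hnn 0 0) t
  have p1 := Real.rpow_nonneg (hnn 1 1) t
  have hp : (A 0 1 ^ t) ^ 2 ≤ A 0 0 ^ t * A 1 1 ^ t := by
    rw [← Real.mul_rpow (hnn 0 0) (hnn 1 1), sq, ← Real.mul_rpow (hnn 0 1) (hnn 0 1), ← sq]
    exact Real.rpow_le_rpow (sq_nonneg _) h ht
  generalize A 0 0 ^ t = a at *
  generalize A 0 1 ^ t = b at *
  generalize A 1 1 ^ t = d at *
  rcases p0.eq_or_lt with rfl | p0
  · have : b = 0 := by nlinarith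
    subst this
    nlinarith [mul_nonneg p1 (sq_nonneg (x 1))]
  · refine (mul_nonneg_iff_of_pos_left p0).1 ?_
    nlinarith [sq_nonneg (a * x 0 + b * x 1), mul_nonneg (sub_nonneg.2 hp) (sq_nonneg (x 1))]

/-- The **FitzGerald–Horn theorem**: Hadamard powers with real exponent at least `N - 2` preserve
positive semidefiniteness of `N × N` matrices with nonnegative entries, `N = n + 2 ≥ 2`. Let `Z` be
the rank-one matrix that agrees with `A` in row and column `0`. Along the segment from `Z` to `A`,
the derivative of the `t`-th power is `t` times the Schur product of `A - Z`, which lives on the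
remaining rows and columns, with a `(t - 1)`-th power. -/
theorem Matrix.PosSemidef.hadamardPow (n : ℕ) :
    ∀ {A : Matrix (Fin (n + 2)) (Fin (n + 2)) ℝ} (_ : A.PosSemidef) (_ : ∀ i j, 0 ≤ A i j)
      {t : ℝ} (_ : n ≤ t), (hadamardPow A t).PosSemidef := by
  induction n with
  | zero => exact fun hA hnn t ht => hA.hadamardPow_fin_two hnn (by simpa using ht)
  | succ n ih =>
    intro A hA hnn t ht
    push_cast at ht
    have hn0 : (0 : ℝ) ≤ n := n.cast_nonneg
    have ht1 : 1 ≤ t := by linarith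
    have hsymm : ∀ i j, A j i = A i j := fun i j => hA.1.apply i j
    set Z : Matrix (Fin (n + 3)) (Fin (n + 3)) ℝ := Matrix.of fun i j => A i 0 * A j 0 / A 0 0
      with hZdef
    have hZnn : ∀ i j, 0 ≤ Z i j := fun i j => by
      have := hnn i 0
      have := hnn j 0
      have := hnn 0 0
      simp only [hZdef, Matrix.of_apply]
      positivity
    -- When `A 0 0 = 0`, column `0` of `A` vanishes, and `Z = 0` by the convention `x / 0 = 0`.
    have hZs : ∀ i, Z i 0 = A i 0 := fun i => by
      simp only [hZdef, Matrix.of_apply]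
      rcases eq_or_ne (A 0 0) 0 with h0 | h0
      · have := hA.sq_le_mul i 0
        rw [h0, mul_zero] at this
        have : A i 0 = 0 := by nlinarith
        simp [this]
      · field_simp
    have hZ : Z.PosSemidef := by
      have := Matrix.posSemidef_vecMulVec_self_star fun i => A i 0 / √(A 0 0)
      convert this using 1
      ext i j
      simp only [hZdef, Matrix.of_apply, Matrix.vecMulVec_apply, star_trivial]
      rw [div_mul_div_comm, Real.mul_self_sqrt (hnn 0 0)]
    have hZt : (_root_.hadamardPow Z t).PosSemidef := by
      have := Matrix.posSemidef_vecMulVec_self_star fun i => A i 0 ^ t / √(A 0 0 ^ t)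
      convert this using 1
      ext i j
      simp only [hZdef, Matrix.of_apply, _root_.hadamardPow, Matrix.vecMulVec_apply, star_trivial]
      rw [div_mul_div_comm, Real.mul_self_sqrt (Real.rpow_nonneg (hnn 0 0) t),
        Real.div_rpow (mul_nonneg (hnn i 0) (hnn j 0)) (hnn 0 0), Real.mul_rpow (hnn i 0) (hnn j 0)]
    have hAZ : (A - Z).PosSemidef := hA.schurComplement_zero
    refine posSemidef_iff_sum.2 ⟨?_, fun x => ?_⟩
    · ext i j
      simp only [_root_.hadamardPow, Matrix.transpose_apply, Matrix.of_apply]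
      rw [hsymm]
    -- The quadratic form of the Hadamard power along the segment from `Z` to `A`.
    set φ : ℝ → ℝ := fun s => ∑ i, ∑ j, x i * (Z i j + s * (A i j - Z i j)) ^ t * x j with hφ
    have hd : ∀ s, HasDerivAt φ (∑ i, ∑ j, x i *
        ((A i j - Z i j) * t * (Z i j + s * (A i j - Z i j)) ^ (t - 1)) * x j) s := by
      intro s
      refine HasDerivAt.fun_sum fun i _ => HasDerivAt.fun_sum fun j _ => ?_
      have : HasDerivAt (fun s => Z i j + s * (A i j - Z i j)) (A i j - Z i j) s := by
        simpa using ((hasDerivAt_id s).mul_const (A i j - Z i j)).const_add (Z i j)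
      exact ((this.rpow_const (Or.inr ht1)).const_mul (x i)).mul_const (x j)
    have hmono : MonotoneOn φ (Set.Icc 0 1) := by
      refine monotoneOn_of_deriv_nonneg (convex_Icc 0 1)
        (fun s _ => (hd s).continuousAt.continuousWithinAt)
        (fun s _ => (hd s).differentiableAt.differentiableWithinAt) ?_
      rw [interior_Icc]
      intro s hs
      rw [(hd s).deriv]
      set M : Matrix (Fin (n + 3)) (Fin (n + 3)) ℝ := (1 - s) • Z + s • A with hM
      have hMps : M.PosSemidef :=
        (hZ.smul (by linarith [hs.2])).add (hA.smul hs.1.le)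
      have hMnn : ∀ i j, 0 ≤ M i j := fun i j =>
        add_nonneg (mul_nonneg (by linarith [hs.2]) (hZnn i j)) (mul_nonneg hs.1.le (hnn i j))
      have hS := (hAZ.submatrix Fin.succ).hadamard (ih (hMps.submatrix Fin.succ)
        (fun i j => hMnn i.succ j.succ) (t := t - 1) (by linarith))
      have hq := (posSemidef_iff_sum.1 hS).2 fun i => x i.succ
      have hMe : ∀ i j, Z i j + s * (A i j - Z i j) = M i j := fun i j => by
        simp only [hM, Matrix.add_apply, Matrix.smul_apply, smul_eq_mul]
        ring
      have h0 : ∀ j, A 0 j - Z 0 j = 0 := fun j => by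
        have : Z 0 j = Z j 0 := by simp [hZdef, mul_comm]
        rw [this, hZs, hsymm, sub_self]
      have h0' : ∀ i, A i 0 - Z i 0 = 0 := fun i => by rw [hZs, sub_self]
      have : ∑ i, ∑ j, x i * ((A i j - Z i j) * t * (Z i j + s * (A i j - Z i j)) ^ (t - 1)) * x j
          = t * ∑ i : Fin (n + 2), ∑ j : Fin (n + 2), x i.succ *
            ((A - Z).submatrix Fin.succ Fin.succ).hadamard
              (_root_.hadamardPow (M.submatrix Fin.succ Fin.succ) (t - 1)) i j * x j.succ := by
        rw [Fin.sum_univ_succ]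
        simp only [h0, zero_mul, mul_zero, Finset.sum_const_zero, zero_add]
        rw [Finset.mul_sum]
        refine Finset.sum_congr rfl fun i _ => ?_
        rw [Fin.sum_univ_succ, Finset.mul_sum]
        simp only [h0', zero_mul, mul_zero, zero_add]
        refine Finset.sum_congr rfl fun j _ => ?_
        simp only [hMe, Matrix.hadamard_apply, Matrix.submatrix_apply, _root_.hadamardPow,
          Matrix.of_apply, Matrix.sub_apply]
        ring
      rw [this]
      exact mul_nonneg (by linarith) hq
    have h01 := hmono (Set.left_mem_Icc.2 zero_le_one) (Set.right_mem_Icc.2 zero_le_one) zero_le_one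
    have hφ0 : 0 ≤ φ 0 := by
      have := (posSemidef_iff_sum.1 hZt).2 x
      simpa [hφ, _root_.hadamardPow] using this
    simpa [hφ, _root_.hadamardPow] using hφ0.trans h01

/-! ### Symmetric matrices of size four -/

theorem IsTotallyNonneg.det_principal_fin_three {A : Matrix (Fin n) (Fin n) ℝ}
    (hA : IsTotallyNonneg A) {a b c : Fin n} (hab : a < b) (hbc : b < c) :
    0 ≤ A a a * A b b * A c c - A a a * A b c * A c b - A a b * A b a * A c c
      + A a b * A b c * A c a + A a c * A b a * A c b - A a c * A b b * A c a := by
  have h := hA 3 (OrderEmbedding.ofStrictMono ![a, b, c] (by simp [hab, hbc]))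
    (OrderEmbedding.ofStrictMono ![a, b, c] (by simp [hab, hbc]))
  rw [Matrix.det_fin_three] at h
  simpa using h

/-- The characteristic polynomial has no negative root: the coefficients of `det (A + c I)` as a
polynomial in `c` are sums of principal minors of `A`. -/
theorem IsTotallyNonneg.det_add_smul_one_pos {A : Matrix (Fin 4) (Fin 4) ℝ}
    (hA : IsTotallyNonneg A) {c : ℝ} (hc : 0 < c) : 0 < (A + c • (1 : Matrix _ _ ℝ)).det := by
  have h1 : 0 ≤ A 0 0 + A 1 1 + A 2 2 + A 3 3 := by
    have := hA.entry_nonneg 0 0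
    have := hA.entry_nonneg 1 1
    have := hA.entry_nonneg 2 2
    have := hA.entry_nonneg 3 3
    linarith
  have m2 := fun (i j : Fin 4) (h : i < j) => hA.mul_le_mul h h
  have a1 := m2 0 1 (by decide)
  have a2 := m2 0 2 (by decide)
  have a3 := m2 0 3 (by decide)
  have a4 := m2 1 2 (by decide)
  have a5 := m2 1 3 (by decide)
  have a6 := m2 2 3 (by decide)
  have b1 := hA.det_principal_fin_three (a := 0) (b := 1) (c := 2) (by decide) (by decide)
  have b2 := hA.det_principal_fin_three (a := 0) (b := 1) (c := 3) (by decide) (by decide)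
  have b3 := hA.det_principal_fin_three (a := 0) (b := 2) (c := 3) (by decide) (by decide)
  have b4 := hA.det_principal_fin_three (a := 1) (b := 2) (c := 3) (by decide) (by decide)
  have h0 := hA.det_nonneg
  have c2 := mul_nonneg (sq_nonneg c) (sub_nonneg.2 (add_le_add (add_le_add (add_le_add
    (add_le_add (add_le_add a1 a2) a3) a4) a5) a6))
  have c3 := mul_nonneg hc.le (add_nonneg (add_nonneg (add_nonneg b1 b2) b3) b4)
  have c1 := mul_nonneg (pow_nonneg hc.le 3) h1
  have c0 := pow_pos hc 4
  have e : (A + c • (1 : Matrix _ _ ℝ)).det = c ^ 4 + c ^ 3 * (A 0 0 + A 1 1 + A 2 2 + A 3 3)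
      + c ^ 2 * ((A 0 0 * A 1 1 + A 0 0 * A 2 2 + A 0 0 * A 3 3 + A 1 1 * A 2 2 + A 1 1 * A 3 3
        + A 2 2 * A 3 3) - (A 0 1 * A 1 0 + A 0 2 * A 2 0 + A 0 3 * A 3 0 + A 1 2 * A 2 1
        + A 1 3 * A 3 1 + A 2 3 * A 3 2))
      + c * ((A 0 0 * A 1 1 * A 2 2 - A 0 0 * A 1 2 * A 2 1 - A 0 1 * A 1 0 * A 2 2
          + A 0 1 * A 1 2 * A 2 0 + A 0 2 * A 1 0 * A 2 1 - A 0 2 * A 1 1 * A 2 0)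
        + (A 0 0 * A 1 1 * A 3 3 - A 0 0 * A 1 3 * A 3 1 - A 0 1 * A 1 0 * A 3 3
          + A 0 1 * A 1 3 * A 3 0 + A 0 3 * A 1 0 * A 3 1 - A 0 3 * A 1 1 * A 3 0)
        + (A 0 0 * A 2 2 * A 3 3 - A 0 0 * A 2 3 * A 3 2 - A 0 2 * A 2 0 * A 3 3
          + A 0 2 * A 2 3 * A 3 0 + A 0 3 * A 2 0 * A 3 2 - A 0 3 * A 2 2 * A 3 0)
        + (A 1 1 * A 2 2 * A 3 3 - A 1 1 * A 2 3 * A 3 2 - A 1 2 * A 2 1 * A 3 3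
          + A 1 2 * A 2 3 * A 3 1 + A 1 3 * A 2 1 * A 3 2 - A 1 3 * A 2 2 * A 3 1))
      + A.det := by
    simp only [Matrix.det_succ_row_zero (n := 3), Matrix.det_fin_three, Fin.sum_univ_four,
      Matrix.submatrix_apply, Matrix.add_apply, Matrix.smul_apply, Matrix.one_apply, smul_eq_mul,
      Fin.succAbove, Fin.succ, Fin.castSucc]
    simp
    ring
  linarith

/-- For a symmetric matrix, nonnegative principal minors exclude negative eigenvalues. -/
theorem IsTotallyNonneg.posSemidef {A : Matrix (Fin 4) (Fin 4) ℝ} (hs : A.IsSymm)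
    (hA : IsTotallyNonneg A) : A.PosSemidef := by
  have hH : A.IsHermitian := hs
  rw [hH.posSemidef_iff_eigenvalues_nonneg]
  intro i
  by_contra! hneg
  have hdet := hA.det_add_smul_one_pos (c := -hH.eigenvalues i) (by simpa using hneg)
  refine hdet.ne' (Matrix.exists_mulVec_eq_zero_iff.1 ⟨hH.eigenvectorBasis i, ?_, ?_⟩)
  · intro h0
    exact hH.eigenvectorBasis.orthonormal.ne_zero i (by ext j; exact congrFun h0 j)
  · rw [Matrix.add_mulVec, hH.mulVec_eigenvectorBasis i, Matrix.smul_mulVec, Matrix.one_mulVec]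
    simp

theorem IsTotallyNonneg.det_hadamardPow_of_le_three (hk : k ≤ 3)
    {A : Matrix (Fin k) (Fin k) ℝ} (hA : IsTotallyNonneg A) {t : ℝ} (ht : 1 ≤ t) :
    0 ≤ (hadamardPow A t).det := by
  match k, hk with
  | 0, _ => simp
  | 1, _ => simpa [hadamardPow] using Real.rpow_nonneg (hA.entry_nonneg 0 0) t
  | 2, _ => exact hA.det_hadamardPow_fin_two (by linarith)
  | 3, _ => exact hA.det_hadamardPow_fin_three ht

theorem hadamardPow_isSymm {A : Matrix (Fin n) (Fin n) ℝ} (hA : A.IsSymm) (t : ℝ) :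
    (hadamardPow A t).IsSymm := by
  ext i j
  simp [hadamardPow, hA.apply j i]

theorem IsTotallyNonneg.det_hadamardPow_fin_four {A : Matrix (Fin 4) (Fin 4) ℝ} (hs : A.IsSymm)
    (hA : IsTotallyNonneg A) {t : ℝ} (ht : 2 ≤ t) : 0 ≤ (hadamardPow A t).det :=
  ((hA.posSemidef hs).hadamardPow 2 hA.entry_nonneg (by exact_mod_cast ht)).det_nonneg

/-- Total positivity is an open condition: only finitely many minors are involved. -/
theorem IsTotallyPos.eventually {A : Matrix (Fin m) (Fin n) ℝ} (hA : IsTotallyPos A)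
    {B : ℝ → Matrix (Fin m) (Fin n) ℝ} (hB : Tendsto B (𝓝[>] 0) (𝓝 A)) :
    ∀ᶠ ε in 𝓝[>] 0, IsTotallyPos (B ε) := by
  have hfin : ∀ k n : ℕ, Finite (Fin k ↪o Fin n) := fun k n =>
    Finite.of_injective (fun f : Fin k ↪o Fin n => (f : Fin k → Fin n)) DFunLike.coe_injective
  have h : ∀ᶠ ε in 𝓝[>] 0, ∀ (k : Fin (m + 1)) (r : Fin k ↪o Fin m) (c : Fin k ↪o Fin n),
      0 < ((B ε).submatrix r c).det := by
    simp only [eventually_all]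
    intro k r c
    have hcont : Continuous fun M : Matrix (Fin m) (Fin n) ℝ => (M.submatrix r c).det :=
      (continuous_id.matrix_submatrix r c).matrix_det
    exact ((hcont.tendsto A).comp hB).eventually_const_lt (hA k r c)
  filter_upwards [h] with ε h k r c
  have hk : k ≤ m := by simpa using Fintype.card_le_of_embedding r.toEmbedding
  exact h ⟨k, by omega⟩ r c

/-- Strict positivity of a determinant from nonnegativity nearby: lowering the corner entry of a
totally positive matrix slightly keeps it totally positive, and lowers the determinant of the
Hadamard power by a positive multiple of the complementary minor. -/
theorem IsTotallyPos.det_hadamardPow_pos {A : Matrix (Fin (k + 1)) (Fin (k + 1)) ℝ}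
    (hA : IsTotallyPos A) {t : ℝ} (ht : 0 < t)
    (hnn : ∀ ε, IsTotallyPos (A - Matrix.single 0 0 ε) →
      0 ≤ (hadamardPow (A - Matrix.single 0 0 ε) t).det)
    (hlow : 0 < (hadamardPow (A.submatrix Fin.succ Fin.succ) t).det) :
    0 < (hadamardPow A t).det := by
  have hlim : Tendsto (fun ε : ℝ => A - Matrix.single 0 0 ε) (𝓝[>] 0) (𝓝 A) := by
    have hc : Continuous fun ε : ℝ => A - Matrix.single 0 0 ε := by
      refine continuous_const.sub (continuous_matrix fun i j => ?_)
      simp only [Matrix.single_apply]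
      split_ifs <;> fun_prop
    have := (hc.tendsto 0).mono_left (nhdsWithin_le_nhds (s := Set.Ioi 0))
    simpa using this
  obtain ⟨ε, hε, hε0⟩ := ((hA.eventually hlim).and self_mem_nhdsWithin).exists
  have hε0 : 0 < ε := hε0
  have hdet := hnn ε hε
  have h00 := hε.isTotallyNonneg.entry_nonneg 0 0
  simp only [Matrix.sub_apply, Matrix.single_apply_same] at h00
  have hlt : (A 0 0 - ε) ^ t < A 0 0 ^ t := Real.rpow_lt_rpow h00 (by linarith) ht
  have e : (hadamardPow A t).det = (hadamardPow (A - Matrix.single 0 0 ε) t).det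
      + (A 0 0 ^ t - (A 0 0 - ε) ^ t) * (hadamardPow (A.submatrix Fin.succ Fin.succ) t).det := by
    have hsub : ∀ j : Fin (k + 1), (A - Matrix.single 0 0 ε).submatrix Fin.succ j.succAbove
        = A.submatrix Fin.succ j.succAbove := fun j => by
      ext a b
      simp [(Fin.succ_ne_zero a).symm]
    rw [Matrix.det_succ_row_zero, Matrix.det_succ_row_zero, Fin.sum_univ_succ, Fin.sum_univ_succ]
    simp only [hadamardPow_submatrix, hsub]
    simp [hadamardPow, Matrix.single_apply, (Fin.succ_ne_zero _).symm]
    ring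
  rw [e]
  have := mul_pos (sub_pos.2 hlt) hlow
  linarith

theorem IsTotallyPos.det_hadamardPow_of_le_three {t : ℝ} (ht : 1 ≤ t) :
    ∀ {k : ℕ} (_ : k ≤ 3) {A : Matrix (Fin k) (Fin k) ℝ} (_ : IsTotallyPos A),
      0 < (hadamardPow A t).det
  | 0, _, _, _ => by simp
  | k + 1, hk, A, hA => hA.det_hadamardPow_pos (by linarith)
      (fun _ h => h.isTotallyNonneg.det_hadamardPow_of_le_three hk ht)
      (IsTotallyPos.det_hadamardPow_of_le_three ht (by omega)
        (hA.submatrix (Fin.succOrderEmb k) (Fin.succOrderEmb k)))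

theorem IsTotallyPos.det_hadamardPow_fin_four {A : Matrix (Fin 4) (Fin 4) ℝ} (hs : A.IsSymm)
    (hA : IsTotallyPos A) {t : ℝ} (ht : 2 ≤ t) : 0 < (hadamardPow A t).det := by
  refine hA.det_hadamardPow_pos (by linarith)
    (fun ε h => h.isTotallyNonneg.det_hadamardPow_fin_four ?_ ht)
    (IsTotallyPos.det_hadamardPow_of_le_three (by linarith) le_rfl
      (hA.submatrix (Fin.succOrderEmb 3) (Fin.succOrderEmb 3)))
  have : (Matrix.single 0 0 ε : Matrix (Fin 4) (Fin 4) ℝ).IsSymm := by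
    simp [Matrix.IsSymm]
  exact hs.sub this

theorem Fin.orderEmbedding_eq_refl (r : Fin n ↪o Fin n) : r = RelEmbedding.refl _ := by
  refine DFunLike.coe_injective ((r.strictMono.range_inj strictMono_id).1 ?_)
  rw [Set.range_id, (Finite.surjective_of_injective r.injective).range_eq]

theorem Fin.le_three_or_eq_four {k : ℕ} (r : Fin k ↪o Fin 4) : k ≤ 3 ∨ k = 4 := by
  have : k ≤ 4 := by simpa using Fintype.card_le_of_embedding r.toEmbedding
  omega

theorem IsTotallyNonneg.hadamardPow_of_isSymm {A : Matrix (Fin 4) (Fin 4) ℝ} (hs : A.IsSymm)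
    (hA : IsTotallyNonneg A) {t : ℝ} (ht : 2 ≤ t) : IsTotallyNonneg (hadamardPow A t) := by
  intro k r c
  rw [hadamardPow_submatrix]
  rcases Fin.le_three_or_eq_four r with hk | rfl
  · exact (hA.submatrix r c).det_hadamardPow_of_le_three hk (by linarith)
  · rw [Fin.orderEmbedding_eq_refl r, Fin.orderEmbedding_eq_refl c]
    exact hA.det_hadamardPow_fin_four hs ht

theorem IsTotallyPos.hadamardPow_of_isSymm {A : Matrix (Fin 4) (Fin 4) ℝ} (hs : A.IsSymm)
    (hA : IsTotallyPos A) {t : ℝ} (ht : 2 ≤ t) : IsTotallyPos (hadamardPow A t) := by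
  intro k r c
  rw [hadamardPow_submatrix]
  rcases Fin.le_three_or_eq_four r with hk | rfl
  · exact IsTotallyPos.det_hadamardPow_of_le_three (by linarith) hk (hA.submatrix r c)
  · rw [Fin.orderEmbedding_eq_refl r, Fin.orderEmbedding_eq_refl c]
    exact hA.det_hadamardPow_fin_four hs ht

/-! ### Failure of closure for exponents between one and two -/

/-- The matrix `(∑ₗ dₗ (xᵢ yⱼ)ˡ)ᵢⱼ`, a weighted product of two Vandermonde type matrices. -/
def momentMatrix (d : Fin 4 → ℝ) (x : Fin m → ℝ) (y : Fin n → ℝ) : Matrix (Fin m) (Fin n) ℝ :=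
  Matrix.of fun i j => ∑ l : Fin 4, d l * (x i * y j) ^ (l : ℕ)

/-- By the Cauchy–Binet formula the determinant is a sum over the `k`-element sets of exponents, of
products of generalized Vandermonde determinants in `x` and in `y`; each of these is the Vandermonde
determinant times a Schur polynomial. -/
theorem momentMatrix_det_pos {d : Fin 4 → ℝ} (hd : ∀ l, 0 < d l) (hk : k ≤ 4) {x y : Fin k → ℝ}
    (hx : StrictMono x) (hy : StrictMono y) (hx0 : ∀ i, 0 ≤ x i) (hy0 : ∀ i, 0 ≤ y i) :
    0 < (momentMatrix d x y).det := by
  have d0 := hd 0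
  have d1 := hd 1
  have d2 := hd 2
  have d3 := hd 3
  match k, hk with
  | 0, _ => simp
  | 1, _ =>
    have := hx0 0
    have := hy0 0
    simp only [momentMatrix, Matrix.det_fin_one, Matrix.of_apply, Fin.sum_univ_four]
    simp
    positivity
  | 2, _ =>
    have x0 := hx0 0
    have x1 := hx0 1
    have y0 := hy0 0
    have y1 := hy0 1
    have hx01 := sub_pos.2 (hx (show (0 : Fin 2) < 1 by decide))
    have hy01 := sub_pos.2 (hy (show (0 : Fin 2) < 1 by decide))
    have e : (momentMatrix d x y).det = (x 1 - x 0) * (y 1 - y 0) * (d 0 * d 1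
        + d 0 * d 2 * ((x 0 + x 1) * (y 0 + y 1))
        + d 0 * d 3 * ((x 0 ^ 2 + x 0 * x 1 + x 1 ^ 2) * (y 0 ^ 2 + y 0 * y 1 + y 1 ^ 2))
        + d 1 * d 2 * (x 0 * x 1 * (y 0 * y 1))
        + d 1 * d 3 * (x 0 * x 1 * (x 0 + x 1) * (y 0 * y 1 * (y 0 + y 1)))
        + d 2 * d 3 * ((x 0 * x 1) ^ 2 * (y 0 * y 1) ^ 2)) := by
      simp only [momentMatrix, Matrix.det_fin_two, Matrix.of_apply, Fin.sum_univ_four]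
      simp
      ring
    rw [e]
    positivity
  | 3, _ =>
    have x0 := hx0 0
    have x1 := hx0 1
    have x2 := hx0 2
    have y0 := hy0 0
    have y1 := hy0 1
    have y2 := hy0 2
    have hx01 := sub_pos.2 (hx (show (0 : Fin 3) < 1 by decide))
    have hy01 := sub_pos.2 (hy (show (0 : Fin 3) < 1 by decide))
    have hx02 := sub_pos.2 (hx (show (0 : Fin 3) < 2 by decide))
    have hy02 := sub_pos.2 (hy (show (0 : Fin 3) < 2 by decide))
    have hx12 := sub_pos.2 (hx (show (1 : Fin 3) < 2 by decide))
    have hy12 := sub_pos.2 (hy (show (1 : Fin 3) < 2 by decide))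
    have e : (momentMatrix d x y).det = ((x 1 - x 0) * (x 2 - x 0) * (x 2 - x 1))
        * ((y 1 - y 0) * (y 2 - y 0) * (y 2 - y 1)) * (d 0 * d 1 * d 2
        + d 0 * d 1 * d 3 * ((x 0 + x 1 + x 2) * (y 0 + y 1 + y 2))
        + d 0 * d 2 * d 3 * ((x 0 * x 1 + x 0 * x 2 + x 1 * x 2)
          * (y 0 * y 1 + y 0 * y 2 + y 1 * y 2))
        + d 1 * d 2 * d 3 * ((x 0 * x 1 * x 2) * (y 0 * y 1 * y 2))) := by
      simp only [momentMatrix, Matrix.det_fin_three, Matrix.of_apply, Fin.sum_univ_four]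
      simp
      ring
    rw [e]
    positivity
  | 4, _ =>
    have e : momentMatrix d x y
        = Matrix.vandermonde x * Matrix.diagonal d * (Matrix.vandermonde y).transpose := by
      ext i j
      rw [Matrix.mul_apply]
      simp only [momentMatrix, Matrix.of_apply, Matrix.mul_diagonal, Matrix.transpose_apply,
        Matrix.vandermonde_apply]
      exact Finset.sum_congr rfl fun l _ => by ring
    have hV : ∀ {z : Fin 4 → ℝ}, StrictMono z → 0 < (Matrix.vandermonde z).det := fun hz => by
      rw [Matrix.det_vandermonde]
      exact Finset.prod_pos fun i _ => Finset.prod_pos fun j hj =>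
        sub_pos.2 (hz (Finset.mem_Ioi.1 hj))
    rw [e, Matrix.det_mul, Matrix.det_mul, Matrix.det_diagonal, Matrix.det_transpose]
    exact mul_pos (mul_pos (hV hx) (Finset.prod_pos fun l _ => hd l)) (hV hy)

theorem momentMatrix_isTotallyPos {d : Fin 4 → ℝ} (hd : ∀ l, 0 < d l) {x y : Fin 4 → ℝ}
    (hx : StrictMono x) (hy : StrictMono y) (hx0 : ∀ i, 0 ≤ x i) (hy0 : ∀ i, 0 ≤ y i) :
    IsTotallyPos (momentMatrix d x y) := fun k r c => by
  have hk : k ≤ 4 := by simpa using Fintype.card_le_of_embedding r.toEmbedding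
  exact momentMatrix_det_pos hd hk (hx.comp r.strictMono) (hy.comp c.strictMono)
    (fun i => hx0 (r i)) (fun i => hy0 (c i))

theorem momentMatrix_self_isSymm (d : Fin 4 → ℝ) (x : Fin n → ℝ) :
    (momentMatrix d x x).IsSymm := by
  ext i j
  simp [momentMatrix, mul_comm]

theorem eventually_neg_of_hasDerivAt {g g' : ℝ → ℝ} (hg : ∀ x, 0 ≤ x → HasDerivAt g (g' x) x)
    (h0 : g 0 = 0) (h : ∀ᶠ x in 𝓝[>] 0, g' x < 0) : ∀ᶠ x in 𝓝[>] 0, g x < 0 := by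
  obtain ⟨η, hη, hη'⟩ := mem_nhdsGT_iff_exists_Ioo_subset.1 h
  filter_upwards [Ioo_mem_nhdsGT hη] with x hx
  have hanti : StrictAntiOn g (Set.Icc 0 x) := by
    refine strictAntiOn_of_deriv_neg (convex_Icc 0 x)
      (fun y hy => (hg y hy.1).continuousAt.continuousWithinAt) fun y hy => ?_
    rw [interior_Icc] at hy
    rw [(hg y hy.1.le).deriv]
    exact hη' ⟨hy.1, hy.2.trans hx.2⟩
  have := hanti (Set.left_mem_Icc.2 hx.1.le) (Set.right_mem_Icc.2 hx.1.le) hx.1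
  rwa [h0] at this

/-- The quadratic form of the matrix `((i j) ^ p (1 + e i j) ^ s)`, `0 ≤ i, j ≤ 3`, at the vector
`(-1, 3, -3, 1)` of third differences, with the terms of equal product `i j` collected. -/
noncomputable def thirdDifferenceForm (p : ℕ) (s e : ℝ) : ℝ :=
  -(0 ^ p * (1 + 0 * e) ^ s) + 9 * (1 ^ p * (1 + 1 * e) ^ s) - 18 * (2 ^ p * (1 + 2 * e) ^ s)
    + 6 * (3 ^ p * (1 + 3 * e) ^ s) + 9 * (4 ^ p * (1 + 4 * e) ^ s)
    - 6 * (6 ^ p * (1 + 6 * e) ^ s) + 9 ^ p * (1 + 9 * e) ^ s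

theorem thirdDifferenceForm_hasDerivAt (p : ℕ) (s : ℝ) {e : ℝ} (he : 0 ≤ e) :
    HasDerivAt (thirdDifferenceForm p s) (s * thirdDifferenceForm (p + 1) (s - 1) e) e := by
  have h : ∀ a : ℝ, 0 ≤ a → HasDerivAt (fun e : ℝ => a ^ p * (1 + a * e) ^ s)
      (a ^ p * (a * s * (1 + a * e) ^ (s - 1))) e := fun a ha => by
    have h1 : HasDerivAt (fun e : ℝ => 1 + a * e) a e := by
      simpa using ((hasDerivAt_id e).const_mul a).const_add 1
    exact (h1.rpow_const (Or.inl (by positivity))).const_mul _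
  have := ((((((h 0 le_rfl).neg.add ((h 1 (by norm_num)).const_mul 9)).sub
    ((h 2 (by norm_num)).const_mul 18)).add ((h 3 (by norm_num)).const_mul 6)).add
    ((h 4 (by norm_num)).const_mul 9)).sub ((h 6 (by norm_num)).const_mul 6)).add
    (h 9 (by norm_num))
  refine this.congr_deriv ?_
  simp only [thirdDifferenceForm]
  ring

/-- Third differences annihilate the terms of degree at most two in the expansion of the form in
`e`, and the term of degree three has the sign of `t (t - 1) (t - 2) < 0`. -/
theorem thirdDifferenceForm_neg {t : ℝ} (h1 : 1 < t) (h2 : t < 2) :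
    ∀ᶠ e in 𝓝[>] 0, thirdDifferenceForm 0 t e < 0 := by
  have z0 : ∀ s : ℝ, thirdDifferenceForm 0 s 0 = 0 := fun s => by
    norm_num [thirdDifferenceForm]
  have z1 : ∀ s : ℝ, thirdDifferenceForm 1 s 0 = 0 := fun s => by
    norm_num [thirdDifferenceForm]
  have z2 : ∀ s : ℝ, thirdDifferenceForm 2 s 0 = 0 := fun s => by
    norm_num [thirdDifferenceForm]
  have z3 : ∀ s : ℝ, thirdDifferenceForm 3 s 0 = 36 := fun s => by
    norm_num [thirdDifferenceForm]
  have e3 : ∀ᶠ e in 𝓝[>] 0, 0 < thirdDifferenceForm 3 (t - 1 - 1 - 1) e := by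
    have hc := (thirdDifferenceForm_hasDerivAt 3 (t - 1 - 1 - 1) le_rfl).continuousAt.tendsto
    refine (hc.mono_left (nhdsWithin_le_nhds (s := Set.Ioi 0))).eventually_const_lt ?_
    rw [z3]
    norm_num
  have e2 : ∀ᶠ e in 𝓝[>] 0, thirdDifferenceForm 2 (t - 1 - 1) e < 0 :=
    eventually_neg_of_hasDerivAt (fun e he => thirdDifferenceForm_hasDerivAt 2 _ he) (z2 _)
      (e3.mono fun e he => mul_neg_of_neg_of_pos (by linarith) he)
  have e1 : ∀ᶠ e in 𝓝[>] 0, thirdDifferenceForm 1 (t - 1) e < 0 :=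
    eventually_neg_of_hasDerivAt (fun e he => thirdDifferenceForm_hasDerivAt 1 _ he) (z1 _)
      (e2.mono fun e he => mul_neg_of_pos_of_neg (by linarith) he)
  exact eventually_neg_of_hasDerivAt (fun e he => thirdDifferenceForm_hasDerivAt 0 _ he) (z0 _)
      (e1.mono fun e he => mul_neg_of_pos_of_neg (by linarith) he)

/-- The matrix `(1 + e i j)` of rank two has a Hadamard power with a negative value of its quadratic
form, and adding small multiples of `((i j) ^ 2)` and `((i j) ^ 3)` makes it totally positive. -/
theorem exists_isTotallyPos_not_isTotallyNonneg_hadamardPow {t : ℝ} (h1 : 1 < t) (h2 : t < 2) :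
    ∃ A : Matrix (Fin 4) (Fin 4) ℝ, A.IsSymm ∧ IsTotallyPos A ∧
      ¬ IsTotallyNonneg (hadamardPow A t) := by
  obtain ⟨e, he, he0⟩ := ((thirdDifferenceForm_neg h1 h2).and self_mem_nhdsWithin).exists
  have he0 : 0 < e := he0
  set x : Fin 4 → ℝ := ![0, 1, 2, 3] with hx
  set v : Fin 4 → ℝ := ![-1, 3, -3, 1] with hv
  set A : ℝ → Matrix (Fin 4) (Fin 4) ℝ := fun δ => momentMatrix ![1, e, δ, δ] x x with hA
  set q : ℝ → ℝ := fun δ => ∑ i, ∑ j, v i * hadamardPow (A δ) t i j * v j with hq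
  have hq0 : q 0 = thirdDifferenceForm 0 t e := by
    simp only [hq, hA, hx, hv, hadamardPow, momentMatrix, thirdDifferenceForm, Fin.sum_univ_four,
      Matrix.of_apply]
    simp
    ring_nf
  have hqc : Continuous q := by
    refine continuous_finsetSum _ fun i _ => continuous_finsetSum _ fun j _ => ?_
    refine (continuous_const.mul ?_).mul continuous_const
    simp only [hadamardPow, hA, momentMatrix, Matrix.of_apply, Fin.sum_univ_four]
    refine Continuous.rpow_const ?_ fun _ => Or.inr (by linarith)
    simp
    fun_prop
  have hneg : ∀ᶠ δ in 𝓝[>] 0, q δ < 0 :=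
    ((hqc.tendsto 0).mono_left (nhdsWithin_le_nhds (s := Set.Ioi 0))).eventually_lt_const
      (by rwa [hq0])
  obtain ⟨δ, hδ, hδ0⟩ := (hneg.and self_mem_nhdsWithin).exists
  have hδ0 : 0 < δ := hδ0
  have hmono : StrictMono x := by
    rw [hx]
    simp
    norm_num
  have hnn : ∀ i, 0 ≤ x i := by
    intro i
    fin_cases i <;> simp [hx]
  have hs : (A δ).IsSymm := momentMatrix_self_isSymm _ _
  refine ⟨A δ, hs, momentMatrix_isTotallyPos ?_ hmono hmono hnn hnn, fun h => ?_⟩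
  · intro l
    fin_cases l <;> simp [he0, hδ0]
  · exact absurd ((posSemidef_iff_sum.1 (h.posSemidef (hadamardPow_isSymm hs t))).2 v) (not_le.2 hδ)

theorem isHadamardCriticalExponent_two_of {C : Set (Matrix (Fin 4) (Fin 4) ℝ)}
    (hC : ∀ A ∈ C, ∀ t : ℝ, 2 ≤ t → hadamardPow A t ∈ C)
    (hpos : ∀ A : Matrix (Fin 4) (Fin 4) ℝ, A.IsSymm → IsTotallyPos A → A ∈ C)
    (hnonneg : ∀ A ∈ C, IsTotallyNonneg A) : IsHadamardCriticalExponent C 2 := by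
  refine ⟨fun t _ ht A hA => hC A hA t ht, fun s hs => ?_⟩
  by_contra! hlt
  obtain ⟨t, hst, ht2⟩ := exists_between (max_lt hlt one_lt_two)
  obtain ⟨hst, ht1⟩ := max_lt_iff.1 hst
  obtain ⟨A, hsymm, hA, hnot⟩ := exists_isTotallyPos_not_isTotallyNonneg_hadamardPow ht1 ht2
  exact hnot (hnonneg _ (hs t (by linarith) hst.le A (hpos A hsymm hA)))

theorem proposition5p6 :
    (∀ A : Matrix (Fin 4) (Fin 4) ℝ, A.IsSymm → IsTotallyNonneg A →
      ∀ t : ℝ, 2 ≤ t → IsTotallyNonneg (hadamardPow A t)) ∧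
    (∀ A : Matrix (Fin 4) (Fin 4) ℝ, A.IsSymm → IsTotallyPos A →
      ∀ t : ℝ, 2 ≤ t → IsTotallyPos (hadamardPow A t)) ∧
    IsHadamardCriticalExponent
      {A : Matrix (Fin 4) (Fin 4) ℝ | A.IsSymm ∧ IsTotallyNonneg A} 2 ∧
    IsHadamardCriticalExponent
      {A : Matrix (Fin 4) (Fin 4) ℝ | A.IsSymm ∧ IsTotallyPos A} 2 :=
  ⟨fun _ hs hA _ ht => hA.hadamardPow_of_isSymm hs ht,
    fun _ hs hA _ ht => hA.hadamardPow_of_isSymm hs ht,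
    isHadamardCriticalExponent_two_of
      (fun _ hA t ht => ⟨hadamardPow_isSymm hA.1 t, hA.2.hadamardPow_of_isSymm hA.1 ht⟩)
      (fun _ hs hA => ⟨hs, hA.isTotallyNonneg⟩) fun _ hA => hA.2,
    isHadamardCriticalExponent_two_of
      (fun _ hA t ht => ⟨hadamardPow_isSymm hA.1 t, hA.2.hadamardPow_of_isSymm hA.1 ht⟩)
      (fun _ hs hA => ⟨hs, hA⟩) fun _ hA => hA.2.isTotallyNonneg⟩
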